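/- Let $1\le p\le\infty$ and let $E,F$ be Banach spaces over $\mathbb K\in\{\mathbb R,\mathbb C\}$, with closed unit ball $B_E$ and dual $E'$, and let $T'\colon F'\to E'$ denote the adjoint of a bounded linear operator $T\colon E\to F$. Write $\ell_p(E)$ for the space of $p$-summable sequences in $E$ with its norm $\|\cdot\|_p$; throughout, for exponent $\infty$ this space is replaced by the space $c_0(E)$ of null sequences with the supremum norm. Let $1/p+1/p'=1$ and, for $(x_n)_n\in\ell_p(E)$, put $p\text{-}\mathrm{co}\{x_n\}=\{\sum_n\alpha_nx_n : (\alpha_n)_n\in\ell_{p'}(\mathbb K),\ \|(\alpha_n)_n\|_{p'}\le 1\}$. An operator $T\colon E\to F$ is $p$-compact, $T\in\mathcal K_p(E;F)$, if $T(B_E)\subset p\text{-}\mathrm{co}\{y_n\}$ for some $(y_n)_n\in\ell_p(F)$; $\kappa_p(T)$ is the infimum of $\|(y_n)_n\|_p$ over all such sequences. It is quasi $p$-nuclear, $T\in\mathcal{QN}_p(E;F)$, if there is $(x_n')_n\in\ell_p(E')$ with $\|Tx\|\le\big(\sum_n|x_n'(x)|^p\big)^{1/p}$ for all $x\in E$ (the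 right side being $\sup_n|x'_n(x)|$ if $p=\infty$); $\nu_p^Q(T)$ is the infimum of $\|(x_n')_n\|_p$ over all such sequences. (Infima over the empty set are $\infty$.) For $\mathcal A=\mathcal K_p$ or $\mathcal{QN}_p$, with norm $\|\cdot\|_{\mathcal A}$, the dual ideal is $\mathcal A^{dual}(E;F)=\{T : T'\in\mathcal A(F';E')\}$ with norm $\|T\|_{\mathcal A^{dual}}=\|T'\|_{\mathcal A}$. Theorem. $\mathcal K_p^{dual}(E;F)=\mathcal{QN}_p(E;F)$ with $\kappa_p(T')=\nu_p^Q(T)$ for every bounded linear $T\colon E\to F$, and $\mathcal{QN}_p^{dual}(E;F)=\mathcal K_p(E;F)$ with $\nu_p^Q(T')=\kappa_p(T)$ for every bounded linear $T\colon E\to F$. In particular, $T$ is $p$-compact if and only if $T'$ is quasi $p$-nuclear, and $\kappa_p(T)=\nu_p^Q(T')$. -/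

import Mathlib

open scoped ENNReal Topology

noncomputable section

namespace PCompact

universe u v w

variable {𝕜 : Type w} [RCLike 𝕜]

/-- The sequences of `ℓ_p(E)` as a subset of Mathlib's `lp`: for `p < ∞` these are all
`p`-summable sequences; for `p = ∞` the convention is that `ℓ_∞(E)` is replaced by the space
`c₀(E)` of null sequences. The norm is the norm of `lp` (the supremum norm if `p = ∞`). -/
def strongSeq (p : ℝ≥0∞) (E : Type u) [NormedAddCommGroup E] :
    Set (lp (fun _ : ℕ => E) p) :=
  {x | p = ∞ → Filter.Tendsto (fun n => x n) Filter.atTop (𝓝 0)}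

/-- The value `(∑ₙ ‖aₙ‖ ^ p) ^ (1/p)` of a scalar sequence, read as `supₙ ‖aₙ‖` if `p = ∞`. It is
only used for sequences for which the series converges (resp. the supremum is finite). -/
def seqNorm (p : ℝ≥0∞) (a : ℕ → 𝕜) : ℝ :=
  if p = ∞ then ⨆ n, ‖a n‖ else (∑' n, ‖a n‖ ^ p.toReal) ^ (1 / p.toReal)

section OneSpace

variable (𝕜) {E : Type u} [NormedAddCommGroup E] [NormedSpace 𝕜 E]

/-- The `p`-convex hull `{∑ₙ αₙ xₙ : (αₙ) ∈ B_{ℓ_{p'}}}` of a sequence, `1/p + 1/p' = 1`,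
with `ℓ_{p'}` replaced by `c₀` if `p = 1`. -/
def pConvexHull (p : ℝ≥0∞) (x : ℕ → E) : Set E :=
  {y | ∃ α ∈ strongSeq p.conjExponent 𝕜, ‖α‖ ≤ 1 ∧ HasSum (fun n => α n • x n) y}

/-- A subset is relatively `p`-compact if it lies in the `p`-convex hull of a sequence of
`ℓ_p(E)`. -/
def IsRelPCompact (p : ℝ≥0∞) (K : Set E) : Prop :=
  ∃ x ∈ strongSeq p E, K ⊆ pConvexHull 𝕜 p (fun n => x n)

end OneSpace

section TwoSpaces

variable {E : Type u} [NormedAddCommGroup E] [NormedSpace 𝕜 E]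
  {F : Type v} [NormedAddCommGroup F] [NormedSpace 𝕜 F]

/-- The adjoint (transpose) `T' : F' → E'`, `y' ↦ y' ∘ T`. -/
def transpose (T : E →L[𝕜] F) : StrongDual 𝕜 F →L[𝕜] StrongDual 𝕜 E :=
  ContinuousLinearMap.precomp 𝕜 T

@[simp]
theorem transpose_apply (T : E →L[𝕜] F) (y' : StrongDual 𝕜 F) (x : E) :
    transpose T y' x = y' (T x) := rfl

/-- The `p`-compact norm `κ_p(T) = inf {‖(xₙ)‖_p : T(B_E) ⊆ p-co{xₙ}}`, which is `∞` if there is no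
such sequence. -/
def kappa (p : ℝ≥0∞) (T : E →L[𝕜] F) : ℝ≥0∞ :=
  ⨅ x ∈ {x ∈ strongSeq p F |
    T '' Metric.closedBall (0 : E) 1 ⊆ pConvexHull 𝕜 p (fun n => x n)}, ENNReal.ofReal ‖x‖

/-- The sequence `(x'ₙ)` of functionals dominates `T`:
`‖T x‖ ≤ (∑ₙ |x'ₙ(x)| ^ p) ^ (1/p)` for all `x`. -/
def Dominates (p : ℝ≥0∞) (x' : ℕ → StrongDual 𝕜 E) (T : E →L[𝕜] F) : Prop :=
  ∀ x : E, ‖T x‖ ≤ seqNorm p (fun n => x' n x)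

/-- The quasi `p`-nuclear norm `ν_p^Q(T)`: the infimum of `‖(x'ₙ)‖_p` over the sequences in
`ℓ_p(E')` that dominate `T`, which is `∞` if there is none. -/
def nuQ (p : ℝ≥0∞) (T : E →L[𝕜] F) : ℝ≥0∞ :=
  ⨅ x' ∈ {x' ∈ strongSeq p (StrongDual 𝕜 E) | Dominates p (fun n => x' n) T},
    ENNReal.ofReal ‖x'‖

/-- The norm of the dual of the ideal of `p`-compact operators. -/
def kappaDual (p : ℝ≥0∞) (T : E →L[𝕜] F) : ℝ≥0∞ := kappa p (transpose T)

/-- The norm of the dual of the ideal of quasi `p`-nuclear operators. -/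
def nuQDual (p : ℝ≥0∞) (T : E →L[𝕜] F) : ℝ≥0∞ := nuQ p (transpose T)

end TwoSpaces

section Components

variable (𝕜) (p : ℝ≥0∞) (E : Type u) [NormedAddCommGroup E] [NormedSpace 𝕜 E]
  (F : Type v) [NormedAddCommGroup F] [NormedSpace 𝕜 F]

/-- `K_p(E; F)`: the operators that map the closed unit ball to a relatively `p`-compact set. -/
def Kp : Set (E →L[𝕜] F) :=
  {T | IsRelPCompact 𝕜 p (T '' Metric.closedBall (0 : E) 1)}

/-- `QN_p(E; F)`: the operators dominated by a sequence in `ℓ_p(E')`. -/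
def QNp : Set (E →L[𝕜] F) :=
  {T | ∃ x' ∈ strongSeq p (StrongDual 𝕜 E), Dominates p (fun n => x' n) T}

/-- The component at `(E, F)` of the dual ideal of `K_p`. -/
def KpDual : Set (E →L[𝕜] F) :=
  {T | transpose T ∈ Kp 𝕜 p (StrongDual 𝕜 F) (StrongDual 𝕜 E)}

/-- The component at `(E, F)` of the dual ideal of `QN_p`. -/
def QNpDual : Set (E →L[𝕜] F) :=
  {T | transpose T ∈ QNp 𝕜 p (StrongDual 𝕜 F) (StrongDual 𝕜 E)}

end Components

end PCompact

end

/-!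
The easy inequalities `ν_p^Q(T) ≤ κ_p(T')` and `ν_p^Q(T') ≤ κ_p(T)` are Hölder's inequality: the
norm of `T x` (resp. `T' y'`) is a supremum over a unit ball whose image lies in a `p`-convex hull
(`nuQ_le_kappa_transpose`, `nuQ_transpose_le_kappa`).

For `κ_p(T') ≤ ν_p^Q(T)`, let `(x'ₙ)` dominate `T`. For `‖y'‖ ≤ 1` the functional `y' ∘ T` is
dominated by the operator `x ↦ (x'ₙ(x))ₙ` into `ℓ_p`, hence factors through it by the Hahn–Banach
theorem, and the coefficients of a functional on `ℓ_p` lie in `ℓ_{p'}` (`HullBound.of_dominates`).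
For `p = 1` this gives coefficients in `ℓ_∞` instead of `c₀`, which is repaired by writing the
sequence `(x'ₙ)` as the product of a null sequence of scalars and a sequence of almost the same
norm (`exists_null_mul`).

Applied to `T'`, this shows that `T''`, and therefore `T` followed by the embedding of `F` into
`F''`, maps the unit ball into the `p`-convex hull of a sequence in `F''`. It remains to replace
that sequence by one in `F` (`HullBound.of_bidual`). By compactness, a family in the hull is
approximated by finitely many of its members, with differences in a hull of small norm in `F''`
(`HullBound.exists_finite_approx`). For finitely many vectors of `F`, a form of local reflexivity
gives a sequence in `F` of no larger norm that represents them up to an error of arbitrarily small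
norm (`exists_pairing_near`); finitely many small vectors lie in a small hull in `F`
(`HullBound.of_finite`). Iterating on the differences writes the family as a series of families
with rapidly decreasing bounds in `F`, and the bound is countably subadditive (`HullBound.hasSum`).
-/

namespace PCompact

/-! ### Null sequences and `p`-summable sequences -/

section Sequences

variable {𝕜 : Type*} [RCLike 𝕜] {p q : ℝ≥0∞}
  {F : Type*} [NormedAddCommGroup F] [NormedSpace 𝕜 F]
  {G : Type*} [NormedAddCommGroup G]

theorem ne_zero_of_fact [hp : Fact (1 ≤ p)] : p ≠ 0 := (zero_lt_one.trans_le hp.out).ne'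

instance fact_one_le_conjExponent : Fact (1 ≤ p.conjExponent) := ⟨by
  rw [ENNReal.conjExponent]
  exact le_self_add⟩

instance holderConjugate_conjExponent [Fact (1 ≤ p)] : p.conjExponent.HolderConjugate p :=
  (inferInstance : p.HolderConjugate p.conjExponent).symm

/-- A sequence dominated in norm by a member of `strongSeq` defines a member of `strongSeq` with
no larger norm. -/
theorem exists_strongSeq_of_norm_le [Fact (1 ≤ p)] {y : lp (fun _ : ℕ => G) p}
    (hy : y ∈ strongSeq p G) {z : ℕ → F} (hz : ∀ n, ‖z n‖ ≤ ‖y n‖) :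
    ∃ w ∈ strongSeq p F, (∀ n, w n = z n) ∧ ‖w‖ ≤ ‖y‖ := by
  refine ⟨⟨z, (lp.memℓp y).mono' hz⟩, fun h => ?_, fun n => rfl,
    lp.norm_mono ne_zero_of_fact hz⟩
  exact squeeze_zero_norm hz (tendsto_zero_iff_norm_tendsto_zero.1 (hy h))

variable (p G) in
/-- `strongSeq p G` as an additive subgroup of `lp`. -/
def strongSubgroup [Fact (1 ≤ p)] : AddSubgroup (lp (fun _ : ℕ => G) p) where
  carrier := strongSeq p G
  zero_mem' := fun _ => by simp
  add_mem' := fun ha hb h => by simpa using (ha h).add (hb h)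
  neg_mem' := fun ha h => by simpa using (ha h).neg

theorem smul_mem_strongSeq (c : 𝕜) {y : lp (fun _ : ℕ => F) p} (hy : y ∈ strongSeq p F) :
    c • y ∈ strongSeq p F := fun h => by simpa using (hy h).const_smul c

theorem hasSum_apply [Fact (1 ≤ p)] {ι : Type*} {y : ι → lp (fun _ : ℕ => G) p}
    {x : lp (fun _ : ℕ => G) p} (h : HasSum y x) (n : ℕ) : HasSum (fun i => y i n) (x n) :=
  h.map ((Pi.evalAddMonoidHom (fun _ : ℕ => G) n).comp (lp.coeFnAddMonoidHom (fun _ : ℕ => G) p))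
    (lp.lipschitzWith_one_eval p n).continuous

theorem isClosed_strongSeq [Fact (1 ≤ p)] : IsClosed (strongSeq p G) := by
  rw [← closure_subset_iff_isClosed]
  intro x hx h
  rw [Metric.tendsto_atTop]
  intro ε hε
  obtain ⟨y, hy, hxy⟩ := Metric.mem_closure_iff.1 hx (ε / 2) (half_pos hε)
  obtain ⟨N, hN⟩ := Metric.tendsto_atTop.1 (hy h) (ε / 2) (half_pos hε)
  refine ⟨N, fun n hn => ?_⟩
  have h1 := hN n hn
  have h2 : ‖x n - y n‖ ≤ ‖x - y‖ := lp.norm_apply_le_norm ne_zero_of_fact (x - y) n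
  rw [dist_eq_norm] at hxy
  rw [dist_zero_right] at h1 ⊢
  have h3 := norm_add_le (x n - y n) (y n)
  rw [sub_add_cancel] at h3
  linarith

theorem mem_strongSeq_of_hasSum [Fact (1 ≤ p)] {ι : Type*} {y : ι → lp (fun _ : ℕ => G) p}
    {x : lp (fun _ : ℕ => G) p} (hy : ∀ i, y i ∈ strongSeq p G) (h : HasSum y x) :
    x ∈ strongSeq p G :=
  isClosed_strongSeq.mem_of_tendsto h
    (Filter.Eventually.of_forall fun _ => (strongSubgroup p G).sum_mem fun i _ => hy i)

theorem single_mem_strongSeq (n : ℕ) (x : G) :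
    lp.single (E := fun _ : ℕ => G) p n x ∈ strongSeq p G := fun _ => by
  refine tendsto_const_nhds.congr' ?_
  filter_upwards [Filter.eventually_gt_atTop n] with m hm
  exact (lp.single_apply_ne (E := fun _ : ℕ => G) p n x hm.ne').symm

/-- Members of `strongSeq` are the unconditional sums of their coordinates. For `p = ∞` this is
the reason for passing to null sequences. -/
theorem hasSum_single_of_mem_strongSeq [Fact (1 ≤ p)] {y : lp (fun _ : ℕ => G) p}
    (hy : y ∈ strongSeq p G) : HasSum (fun n => lp.single p n (y n)) y := by
  by_cases hp : p = ∞
  · subst hp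
    rw [HasSum, SummationFilter.unconditional_filter, Metric.tendsto_atTop]
    intro ε hε
    obtain ⟨N, hN⟩ := Metric.tendsto_atTop.1 (hy rfl) (ε / 2) (half_pos hε)
    refine ⟨Finset.range N, fun s hs => ?_⟩
    rw [dist_eq_norm]
    refine (lp.norm_le_of_forall_le (half_pos hε).le fun n => ?_).trans_lt (half_lt_self hε)
    rw [lp.coeFn_sub, Pi.sub_apply, lp.coeFn_sum, Finset.sum_apply]
    simp only [lp.single_apply]
    rw [Finset.sum_pi_single]
    split_ifs with h
    · simpa using (half_pos hε).le
    · have : N ≤ n := by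
        by_contra hlt
        exact h (hs (Finset.mem_range.2 (not_le.1 hlt)))
      simpa using (hN n this).le
  · exact lp.hasSum_single hp y

/-- Multiplying the terms of a sequence by bounded scalars. -/
theorem exists_mul_le [Fact (1 ≤ p)] {C : ℝ} (hC : 0 ≤ C) (a : lp (fun _ : ℕ => 𝕜) p)
    {μ : ℕ → ℝ} (hμ : ∀ n, |μ n| ≤ C) :
    ∃ b : lp (fun _ : ℕ => 𝕜) p, (∀ n, b n = (μ n : 𝕜) * a n) ∧ ‖b‖ ≤ C * ‖a‖ := by
  have h : ∀ n, ‖(μ n : 𝕜) * a n‖ ≤ ‖((C : 𝕜) • a) n‖ := fun n => by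
    rw [lp.coeFn_smul, Pi.smul_apply, norm_smul, norm_mul, RCLike.norm_ofReal, RCLike.norm_ofReal,
      abs_of_nonneg hC]
    exact mul_le_mul_of_nonneg_right (hμ n) (norm_nonneg _)
  refine ⟨⟨fun n => (μ n : 𝕜) * a n, (lp.memℓp ((C : 𝕜) • a)).mono' h⟩, fun n => rfl, ?_⟩
  refine (lp.norm_mono ne_zero_of_fact h).trans ?_
  rw [norm_smul, RCLike.norm_ofReal, abs_of_nonneg hC]

variable (𝕜) in
/-- Every sequence in `strongSeq` is the product of a null sequence of scalars and a sequence in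
`strongSeq` of almost the same norm: add the tails of `y` beyond the terms of a rapidly increasing
sequence of indices. -/
theorem exists_null_mul [Fact (1 ≤ p)] [CompleteSpace F] {y : lp (fun _ : ℕ => F) p}
    (hy : y ∈ strongSeq p F) {ε : ℝ} (hε : 0 < ε) :
    ∃ μ : ℕ → ℝ, (∀ n, 0 ≤ μ n) ∧ (∀ n, μ n ≤ 1) ∧ Filter.Tendsto μ Filter.atTop (𝓝 0) ∧
      ∃ u ∈ strongSeq p F, ‖u‖ ≤ ‖y‖ + ε ∧ ∀ n, y n = (μ n : 𝕜) • u n := by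
  set t : ℕ → lp (fun _ : ℕ => F) p :=
    fun N => y - ∑ n ∈ Finset.range N, lp.single p n (y n) with ht
  have ht0 : Filter.Tendsto t Filter.atTop (𝓝 0) := by
    have := (hasSum_single_of_mem_strongSeq hy).tendsto_sum_nat
    simpa [ht] using this.const_sub y
  have htapp : ∀ N n, t N n = if N ≤ n then y n else 0 := fun N n => by
    rw [ht, lp.coeFn_sub, Pi.sub_apply, lp.coeFn_sum, Finset.sum_apply]
    simp only [lp.single_apply]
    rw [Finset.sum_pi_single]
    by_cases h : N ≤ n
    · simp [h]
    · simp [h, not_le.1 h]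
  have htmem : ∀ N, t N ∈ strongSeq p F := fun N =>
    (strongSubgroup p F).sub_mem hy
      ((strongSubgroup p F).sum_mem fun n _ => single_mem_strongSeq n _)
  have hex : ∀ j : ℕ, ∃ N, ‖t N‖ ≤ ε / 2 * (1 / 2) ^ j ∧ j ≤ N := fun j => by
    have : 0 < ε / 2 * (1 / 2) ^ j := by positivity
    obtain ⟨N, hN⟩ := Metric.tendsto_atTop.1 ht0 _ this
    exact ⟨max N j, by simpa using (hN (max N j) (le_max_left _ _)).le, le_max_right _ _⟩
  choose N hN hjN using hex
  have hgeo : HasSum (fun j : ℕ => ε / 2 * (1 / 2 : ℝ) ^ j) ε := by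
    simpa using hasSum_geometric_two.mul_left (ε / 2)
  have hsum : HasSum (fun j => t (N j)) (∑' j, t (N j)) :=
    (Summable.of_norm_bounded hgeo.summable hN).hasSum
  -- `c n` counts the tails that contain the `n`-th term.
  set c : ℕ → ℕ := fun n => ((Finset.range (n + 1)).filter fun j => N j ≤ n).card with hc
  have happ : ∀ n, (∑' j, t (N j)) n = (c n : 𝕜) • y n := fun n => by
    have h1 : HasSum (fun j => t (N j) n) ((∑' j, t (N j)) n) :=
      hasSum_apply hsum n
    have h2 : HasSum (fun j => t (N j) n) (∑ j ∈ Finset.range (n + 1), t (N j) n) := by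
      refine hasSum_sum_of_ne_finset_zero fun j hj => ?_
      rw [htapp, if_neg]
      have := hjN j
      simp only [Finset.mem_range] at hj
      omega
    rw [h1.unique h2]
    simp only [htapp]
    rw [← Finset.sum_filter, Finset.sum_const, Nat.cast_smul_eq_nsmul]
  have hct : Filter.Tendsto (fun n => 1 + (c n : ℝ)) Filter.atTop Filter.atTop := by
    refine Filter.tendsto_atTop_add_const_left _ _ (tendsto_natCast_atTop_atTop.comp ?_)
    refine Filter.tendsto_atTop.2 fun M => ?_
    have hev : ∀ᶠ n in Filter.atTop, ∀ j ∈ Finset.range M, N j ≤ n :=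
      (Filter.eventually_all_finset _).2 fun j _ => Filter.eventually_ge_atTop (N j)
    filter_upwards [hev] with n hn
    rw [← Finset.card_range M]
    refine Finset.card_le_card fun j hj => Finset.mem_filter.2 ⟨?_, hn j hj⟩
    have := hjN j
    have := hn j hj
    rw [Finset.mem_range]
    omega
  have hpos : ∀ n, 0 < 1 + (c n : ℝ) := fun n => by positivity
  refine ⟨fun n => (1 + (c n : ℝ))⁻¹, fun n => (inv_pos.2 (hpos n)).le,
    fun n => inv_le_one_of_one_le₀ (by simp), hct.inv_tendsto_atTop, y + ∑' j, t (N j),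
    (strongSubgroup p F).add_mem hy (mem_strongSeq_of_hasSum (fun j => htmem (N j)) hsum),
    (norm_add_le _ _).trans (add_le_add le_rfl (tsum_of_norm_bounded hgeo hN)), fun n => ?_⟩
  have hne : (1 + (c n : 𝕜)) ≠ 0 := by
    have := (hpos n).ne'
    exact_mod_cast this
  rw [lp.coeFn_add, Pi.add_apply, happ]
  push_cast
  rw [show y n + (c n : 𝕜) • y n = (1 + (c n : 𝕜)) • y n by rw [add_smul, one_smul], smul_smul,
    inv_mul_cancel₀ hne, one_smul]

/-! ### The pairing of `ℓ_{p'}` and `ℓ_p(F)`, and the dual of `ℓ_p` -/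

section Pairing

variable [Fact (1 ≤ p)] [Fact (1 ≤ q)] [q.HolderConjugate p] [CompleteSpace F]

variable (𝕜 p q F) in
/-- The pairing `(α, y) ↦ ∑ₙ αₙ yₙ` of `ℓ_q(𝕜)` and `ℓ_p(F)`. -/
noncomputable def pairing : lp (fun _ : ℕ => 𝕜) q →L[𝕜] lp (fun _ : ℕ => F) p →L[𝕜] F :=
  lp.dualPairing q p (fun _ => ContinuousLinearMap.lsmul 𝕜 𝕜) (K := 1)
    fun _ => ContinuousLinearMap.opNorm_lsmul_le

theorem hasSum_pairing (a : lp (fun _ : ℕ => 𝕜) q) (y : lp (fun _ : ℕ => F) p) :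
    HasSum (fun n => a n • y n) (pairing 𝕜 p q F a y) := by
  have h := (lp.memℓp a).holder 1 (lp.memℓp y) (fun _ => ContinuousLinearMap.lsmul 𝕜 𝕜) (K := 1)
    fun _ => ContinuousLinearMap.opNorm_lsmul_le
  exact h.summable_of_one.hasSum

theorem norm_pairing_le (a : lp (fun _ : ℕ => 𝕜) q) (y : lp (fun _ : ℕ => F) p) :
    ‖pairing 𝕜 p q F a y‖ ≤ ‖a‖ * ‖y‖ := by
  have h : ‖pairing 𝕜 p q F‖ ≤ (1 : NNReal) := lp.norm_dualPairing _ _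
  simpa using (pairing 𝕜 p q F).le_of_opNorm₂_le_of_le h le_rfl le_rfl

theorem pairing_eq {a : lp (fun _ : ℕ => 𝕜) q} {y : lp (fun _ : ℕ => F) p} {x : F}
    (h : HasSum (fun n => a n • y n) x) : pairing 𝕜 p q F a y = x :=
  (hasSum_pairing a y).unique h

end Pairing

section Extend

variable [Fact (1 ≤ p)]

/-- Extension of a sequence by zero along an injection of the index set. -/
theorem exists_extend {g : ℕ → ℕ} (hg : g.Injective) (f : lp (fun _ : ℕ => G) p) :
    ∃ w : lp (fun _ : ℕ => G) p, ⇑w = Function.extend g f 0 ∧ ‖w‖ ≤ ‖f‖ := by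
  by_cases hp : p = ∞
  · subst hp
    have h : ∀ n, ‖Function.extend g f 0 n‖ ≤ ‖f‖ := fun n => by
      by_cases hn : ∃ m, g m = n
      · obtain ⟨m, rfl⟩ := hn
        rw [hg.extend_apply]
        exact lp.norm_apply_le_norm ENNReal.top_ne_zero f m
      · rw [Function.extend_apply' _ _ _ hn]
        simp
    exact ⟨⟨Function.extend g f 0, memℓp_infty ⟨‖f‖, by rintro _ ⟨n, rfl⟩; exact h n⟩⟩, rfl,
      lp.norm_le_of_forall_le (norm_nonneg _) h⟩
  · have hp0 : 0 < p.toReal := ENNReal.toReal_pos ne_zero_of_fact hp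
    have h0 : ∀ n ∉ Set.range g, ‖Function.extend g f 0 n‖ ^ p.toReal = 0 := fun n hn => by
      rw [Function.extend_apply' _ _ _ hn]
      simp [hp0.ne']
    have hs : HasSum (fun n => ‖Function.extend g f 0 n‖ ^ p.toReal) (‖f‖ ^ p.toReal) := by
      rw [← hg.hasSum_iff h0]
      simpa [Function.comp_def, hg.extend_apply] using lp.hasSum_norm hp0 f
    exact ⟨⟨Function.extend g f 0, memℓp_gen hs.summable⟩, rfl,
      lp.norm_le_of_tsum_le hp0 (norm_nonneg _) hs.tsum_eq.le⟩

end Extend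

section Dual

variable [Fact (1 ≤ p)] [Fact (1 ≤ q)] [q.HolderConjugate p]

/-- Testing a functional on finitely supported sequences; the signs of its coefficients do not
affect the norm of the test sequence. -/
theorem sum_norm_coeff_mul_le (f : StrongDual 𝕜 (lp (fun _ : ℕ => 𝕜) p)) (s : Finset ℕ)
    (w : ℕ → ℝ) :
    ∑ n ∈ s, ‖f (lp.single p n 1)‖ * w n ≤
      ‖f‖ * ‖∑ n ∈ s, lp.single (E := fun _ : ℕ => 𝕜) p n (w n : 𝕜)‖ := by
  have hu : ∀ z : 𝕜, ∃ u : 𝕜, ‖u‖ ≤ 1 ∧ u * z = ‖z‖ := fun z => by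
    by_cases hz : z = 0
    · exact ⟨0, by simp, by simp [hz]⟩
    · have hz' : (‖z‖ : 𝕜) ≠ 0 := by simpa using hz
      refine ⟨(starRingEnd 𝕜) z / ‖z‖, by simp [hz], ?_⟩
      rw [div_mul_eq_mul_div, RCLike.conj_mul, pow_two, mul_div_cancel_right₀ _ hz']
  choose u hu1 hu2 using hu
  set v : ℕ → 𝕜 := fun n => w n * u (f (lp.single p n 1)) with hv
  have hfv : f (∑ n ∈ s, lp.single p n (v n)) =
      ((∑ n ∈ s, ‖f (lp.single p n 1)‖ * w n : ℝ) : 𝕜) := by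
    rw [map_sum, RCLike.ofReal_sum]
    refine Finset.sum_congr rfl fun n _ => ?_
    have : lp.single (E := fun _ : ℕ => 𝕜) p n (v n) = v n • lp.single p n (1 : 𝕜) := by
      rw [← lp.single_smul, smul_eq_mul, mul_one]
    rw [this, map_smul, smul_eq_mul, hv, mul_assoc, hu2]
    push_cast
    ring
  have hle : ‖∑ n ∈ s, lp.single (E := fun _ : ℕ => 𝕜) p n (v n)‖ ≤
      ‖∑ n ∈ s, lp.single (E := fun _ : ℕ => 𝕜) p n (w n : 𝕜)‖ := by
    refine lp.norm_mono ne_zero_of_fact fun n => ?_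
    rw [lp.coeFn_sum, lp.coeFn_sum, Finset.sum_apply, Finset.sum_apply]
    simp only [lp.single_apply]
    rw [Finset.sum_pi_single, Finset.sum_pi_single]
    split_ifs
    · rw [hv, norm_mul]
      exact mul_le_of_le_one_right (norm_nonneg _) (hu1 _)
    · rfl
  calc _ ≤ ‖((∑ n ∈ s, ‖f (lp.single p n 1)‖ * w n : ℝ) : 𝕜)‖ := by
        rw [RCLike.norm_ofReal]
        exact le_abs_self _
    _ ≤ _ := by
        rw [← hfv]
        exact (f.le_opNorm _).trans (mul_le_mul_of_nonneg_left hle (norm_nonneg _))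

variable (q) in
/-- The coefficients of a functional on `ℓ_p` form a sequence in `ℓ_q` with at most its norm. -/
theorem exists_coeff (f : StrongDual 𝕜 (lp (fun _ : ℕ => 𝕜) p)) :
    ∃ a : lp (fun _ : ℕ => 𝕜) q, (∀ n, a n = f (lp.single p n 1)) ∧ ‖a‖ ≤ ‖f‖ := by
  have hp0 : 0 < p := zero_lt_one.trans_le Fact.out
  by_cases hq : q = ∞
  · subst hq
    have h : ∀ n, ‖f (lp.single p n 1)‖ ≤ ‖f‖ := fun n =>
      (f.le_opNorm _).trans_eq (by rw [lp.norm_single hp0, norm_one, mul_one])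
    exact ⟨⟨fun n => f (lp.single p n 1), memℓp_infty ⟨‖f‖, by rintro _ ⟨n, rfl⟩; exact h n⟩⟩,
      fun n => rfl, lp.norm_le_of_forall_le (norm_nonneg _) h⟩
  have hq0 : 0 < q.toReal := ENNReal.toReal_pos ne_zero_of_fact hq
  suffices h : ∀ s : Finset ℕ, ∑ n ∈ s, ‖f (lp.single p n 1)‖ ^ q.toReal ≤ ‖f‖ ^ q.toReal from
    ⟨⟨fun n => f (lp.single p n 1), memℓp_gen' h⟩, fun n => rfl,
      lp.norm_le_of_forall_sum_le hq0 (norm_nonneg _) h⟩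
  intro s
  by_cases hp : p = ∞
  · subst hp
    obtain rfl : q = 1 := ENNReal.HolderConjugate.unique ∞ q 1
    have h1 : ‖∑ n ∈ s, lp.single (E := fun _ : ℕ => 𝕜) ∞ n ((1 : ℝ) : 𝕜)‖ ≤ 1 := by
      refine lp.norm_le_of_forall_le zero_le_one fun n => ?_
      rw [lp.coeFn_sum, Finset.sum_apply]
      simp only [lp.single_apply]
      rw [Finset.sum_pi_single]
      split_ifs <;> simp
    simpa using (sum_norm_coeff_mul_le f s fun _ => 1).trans
      (mul_le_of_le_one_right (norm_nonneg _) h1)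
  · have hp0' : 0 < p.toReal := ENNReal.toReal_pos ne_zero_of_fact hp
    have hqp : q.toReal.HolderConjugate p.toReal := ENNReal.HolderConjugate.toReal_of_ne_top hq hp
    obtain ⟨g, hg, hgs⟩ := (NNReal.isGreatest_Lp s (fun n => ‖f (lp.single p n 1)‖₊) hqp).1
    have h1 : ‖∑ n ∈ s, lp.single (E := fun _ : ℕ => 𝕜) p n ((g n : ℝ) : 𝕜)‖ ≤ 1 := by
      rw [← Real.rpow_le_rpow_iff (norm_nonneg _) zero_le_one hp0', Real.one_rpow,
        lp.norm_sum_single hp0' (fun n => ((g n : ℝ) : 𝕜)) s]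
      simp only [RCLike.norm_ofReal, NNReal.abs_eq]
      exact_mod_cast hg
    have h2 := (sum_norm_coeff_mul_le f s fun n => g n).trans
      (mul_le_of_le_one_right (norm_nonneg _) h1)
    have h3 : ∑ n ∈ s, ‖f (lp.single p n 1)‖ * g n =
        (∑ n ∈ s, ‖f (lp.single p n 1)‖ ^ q.toReal) ^ (1 / q.toReal) := by
      have := congrArg ((↑) : NNReal → ℝ) hgs
      push_cast at this
      exact this
    rw [h3, one_div, Real.rpow_inv_le_iff_of_pos (by positivity) (norm_nonneg _) hq0] at h2
    exact h2

end Dual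

end Sequences

/-! ### Families in the `p`-convex hull of a sequence of bounded norm -/

section HullBound

variable {𝕜 : Type*} [RCLike 𝕜] {p q : ℝ≥0∞}
  [Fact (1 ≤ p)] [Fact (1 ≤ q)] [q.HolderConjugate p]
  {F : Type*} [NormedAddCommGroup F] [NormedSpace 𝕜 F] [CompleteSpace F] {ι : Type*}

theorem pairing_single (n : ℕ) (c : 𝕜) (y : lp (fun _ : ℕ => F) p) :
    pairing 𝕜 p q F (lp.single q n c) y = c • y n := by
  refine pairing_eq ?_
  convert! hasSum_single (f := fun m => (lp.single (E := fun _ : ℕ => 𝕜) q n c) m • y m) n ?_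
    using 1
  · simp
  · intro m hm
    rw [lp.single_apply_ne _ _ _ hm, zero_smul]

theorem pairing_extend {g : ℕ → ℕ} (hg : g.Injective) {a A : lp (fun _ : ℕ => 𝕜) q}
    {z Z : lp (fun _ : ℕ => F) p} (hA : ⇑A = Function.extend g a 0)
    (hZ : ⇑Z = Function.extend g z 0) :
    pairing 𝕜 p q F A Z = pairing 𝕜 p q F a z := by
  refine pairing_eq ((hg.hasSum_iff fun n hn => ?_).1 ?_)
  · rw [hZ, Function.extend_apply' _ _ _ hn, Pi.zero_apply, smul_zero]
  · simpa [Function.comp_def, hA, hZ, hg.extend_apply] using hasSum_pairing a z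

theorem pairing_eq_zero {a : lp (fun _ : ℕ => 𝕜) q} {z : lp (fun _ : ℕ => F) p}
    (h : ∀ n, a n = 0 ∨ z n = 0) : pairing 𝕜 p q F a z = 0 := by
  refine pairing_eq ?_
  simp_rw [fun n => smul_eq_zero.2 (h n)]
  exact hasSum_zero

theorem pairing_eq_of_mul {a b : lp (fun _ : ℕ => 𝕜) q} {y u : lp (fun _ : ℕ => F) p} {μ : ℕ → ℝ}
    (hb : ∀ n, b n = (μ n : 𝕜) * a n) (hy : ∀ n, y n = (μ n : 𝕜) • u n) :
    pairing 𝕜 p q F b u = pairing 𝕜 p q F a y :=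
  pairing_eq ((hasSum_pairing a y).congr_fun fun n => by rw [hb, hy, smul_smul, mul_comm])

variable (𝕜 p q) in
/-- The family `k` lies in the `p`-convex hull of a sequence of `strongSeq p F` of norm at most `c`.
The coefficient sequences range over the unit ball of `ℓ_q`, also for `q = ∞`. -/
def HullBound (k : ι → F) (c : ℝ) : Prop :=
  ∃ y ∈ strongSeq p F, ‖y‖ ≤ c ∧
    ∀ i, ∃ a : lp (fun _ : ℕ => 𝕜) q, ‖a‖ ≤ 1 ∧ pairing 𝕜 p q F a y = k i

namespace HullBound

theorem mono {k : ι → F} {c d : ℝ} (h : HullBound 𝕜 p q k c) (hcd : c ≤ d) :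
    HullBound 𝕜 p q k d :=
  let ⟨y, hy, hyc, ha⟩ := h
  ⟨y, hy, hyc.trans hcd, ha⟩

theorem comp {κ : Type*} {k : ι → F} {c : ℝ} (h : HullBound 𝕜 p q k c) (j : κ → ι) :
    HullBound 𝕜 p q (fun x => k (j x)) c :=
  let ⟨y, hy, hyc, ha⟩ := h
  ⟨y, hy, hyc, fun x => ha (j x)⟩

theorem nonneg {k : ι → F} {c : ℝ} (h : HullBound 𝕜 p q k c) : 0 ≤ c :=
  let ⟨_, _, hyc, _⟩ := h
  (norm_nonneg _).trans hyc

theorem norm_le {k : ι → F} {c : ℝ} (h : HullBound 𝕜 p q k c) (i : ι) : ‖k i‖ ≤ c := by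
  obtain ⟨y, -, hyc, ha⟩ := h
  obtain ⟨a, ha1, hai⟩ := ha i
  rw [← hai]
  exact (norm_pairing_le a y).trans
    ((mul_le_of_le_one_left (norm_nonneg _) ha1).trans hyc)

variable (𝕜 p q) in
theorem zero {c : ℝ} (hc : 0 ≤ c) : HullBound 𝕜 p q (fun _ : ι => (0 : F)) c :=
  ⟨0, (strongSubgroup p F).zero_mem, by simpa using hc, fun _ => ⟨0, by simp, by simp⟩⟩

/-- At the cost of an arbitrarily small increase of the norm, the coefficients can be taken to be
null sequences. -/
theorem exists_range_subset {k : ι → F} {c : ℝ}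
    (h : HullBound 𝕜 p p.conjExponent k c) {ε : ℝ} (hε : 0 < ε) :
    ∃ u ∈ strongSeq p F, ‖u‖ ≤ c + ε ∧ Set.range k ⊆ pConvexHull 𝕜 p fun n => u n := by
  obtain ⟨y, hy, hyc, ha⟩ := h
  obtain ⟨μ, hμ0, hμ1, hμ, u, hu, huy, hyu⟩ := exists_null_mul 𝕜 hy hε
  refine ⟨u, hu, huy.trans (by linarith), ?_⟩
  rintro _ ⟨i, rfl⟩
  obtain ⟨a, ha1, hai⟩ := ha i
  obtain ⟨b, hb, hba⟩ := exists_mul_le zero_le_one a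
    fun n => (abs_of_nonneg (hμ0 n)).trans_le (hμ1 n)
  refine ⟨b, fun _ => ?_, by simpa using hba.trans (mul_le_mul_of_nonneg_left ha1 zero_le_one), ?_⟩
  · refine squeeze_zero_norm (fun n => ?_) hμ
    rw [hb, norm_mul, RCLike.norm_ofReal, abs_of_nonneg (hμ0 n)]
    exact mul_le_of_le_one_right (hμ0 n)
      ((lp.norm_apply_le_norm ne_zero_of_fact a n).trans ha1)
  · rw [← hai, ← pairing_eq_of_mul hb hyu]
    exact hasSum_pairing b u

/-- The bound is countably subadditive, with weights: the sequences are arranged on disjoint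
subsets of the index set. -/
theorem hasSum {k : ℕ → ι → F} {g : ι → F} {w c : ℕ → ℝ} {C : ℝ} (hw : ∀ j, 0 < w j)
    (hw1 : HasSum w 1) (hc : HasSum c C) (hk : ∀ j, HullBound 𝕜 p q (k j) (w j * c j))
    (hg : ∀ i, HasSum (fun j => k j i) (g i)) : HullBound 𝕜 p q g C := by
  choose y hy hyc ha using hk
  choose a ha1 hak using ha
  have hinj : ∀ j, Function.Injective (Nat.pair j) := fun j m n h => by simpa using h
  choose z hz hzn using fun j => exists_extend (hinj j) (((w j)⁻¹ : 𝕜) • y j)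
  choose b hb hbn using fun i j => exists_extend (hinj j) ((w j : 𝕜) • a j i)
  have hzc : ∀ j, ‖z j‖ ≤ c j := fun j => by
    refine (hzn j).trans ?_
    rw [norm_smul, norm_inv, RCLike.norm_ofReal, abs_of_pos (hw j), inv_mul_le_iff₀ (hw j)]
    exact hyc j
  have hbw : ∀ i j, ‖b i j‖ ≤ w j := fun i j => by
    refine (hbn i j).trans ?_
    rw [norm_smul, RCLike.norm_ofReal, abs_of_pos (hw j)]
    exact mul_le_of_le_one_right (hw j).le (ha1 j i)
  have hzmem : ∀ j, z j ∈ strongSeq p F := fun j hp => by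
    rw [hz]
    have h0 := smul_mem_strongSeq ((w j : 𝕜)⁻¹) (hy j) hp
    rw [Metric.tendsto_atTop] at h0 ⊢
    intro ε hε
    obtain ⟨N, hN⟩ := h0 ε hε
    -- Only finitely many values of the extension come from indices below `N`
    refine ⟨(Finset.range N).sup (Nat.pair j) + 1, fun m hm => ?_⟩
    by_cases hmj : ∃ n, Nat.pair j n = m
    · obtain ⟨n, rfl⟩ := hmj
      rw [(hinj j).extend_apply]
      refine hN n (not_lt.1 fun hn => ?_)
      have := Finset.le_sup (f := Nat.pair j) (Finset.mem_range.2 hn)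
      omega
    · rw [Function.extend_apply' _ _ _ hmj]
      simpa using hε
  have hzsum := (Summable.of_norm_bounded hc.summable hzc).hasSum
  refine ⟨∑' j, z j, mem_strongSeq_of_hasSum hzmem hzsum, tsum_of_norm_bounded hc hzc,
    fun i => ⟨∑' j, b i j, tsum_of_norm_bounded hw1 (hbw i), ?_⟩⟩
  have hbsum := (Summable.of_norm_bounded hw1.summable (hbw i)).hasSum
  have h1 : ∀ j, pairing 𝕜 p q F (∑' j, b i j) (z j) = k j i := fun j => by
    have h2 := ((pairing 𝕜 p q F).flip (z j)).hasSum hbsum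
    refine h2.unique ?_
    convert! hasSum_single (f := fun l => (pairing 𝕜 p q F).flip (z j) (b i l)) j ?_ using 1
    · rw [ContinuousLinearMap.flip_apply, pairing_extend (hinj j) (hb i j) (hz j), map_smul,
        map_smul, smul_apply, smul_smul, inv_mul_cancel₀, one_smul, hak]
      exact_mod_cast (hw j).ne'
    · intro l hl
      rw [ContinuousLinearMap.flip_apply]
      apply pairing_eq_zero
      intro n
      by_cases hn : ∃ m, Nat.pair l m = n
      · right
        rw [hz, Function.extend_apply']
        · rfl
        · rintro ⟨m', hm'⟩
          obtain ⟨m, rfl⟩ := hn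
          exact hl (Nat.pair_eq_pair.1 hm').1.symm
      · left
        rw [hb, Function.extend_apply' _ _ _ hn]
        rfl
  have h3 := ((pairing 𝕜 p q F (∑' j, b i j))).hasSum hzsum
  simp only [h1] at h3
  exact h3.unique (hg i)

variable (𝕜 p q F ι) in
/-- Adding a rapidly decreasing series of families increases the bound only slightly. -/
theorem exists_hasSum_of_geometric {c ε : ℝ} (hc : 0 ≤ c) (hε : 0 < ε) :
    ∃ D > 0, ∀ (k : ℕ → ι → F) (g : ι → F), HullBound 𝕜 p q (k 0) c →
      (∀ j, HullBound 𝕜 p q (k (j + 1)) (D * (1 / 4) ^ j)) →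
      (∀ i, HasSum (fun j => k j i) (g i)) → HullBound 𝕜 p q g (c + ε) := by
  -- The weight `θ < 1` of the first family leaves room for the weights of the others, and is so
  -- close to `1` that `c / θ ≤ c + ε / 2`.
  set θ : ℝ := (c + ε / 4) / (c + ε / 2) with hθ
  have hθ0 : 0 < θ := by positivity
  have hθ1 : θ < 1 := by
    rw [hθ, div_lt_one (by positivity)]
    linarith
  set w : ℕ → ℝ := fun j => Nat.casesOn j θ fun n => (1 - θ) * (1 / 2 * (1 / 2) ^ n) with hw
  set d : ℕ → ℝ := fun j => Nat.casesOn j (c + ε / 2) fun n => ε / 2 * (1 / 2 * (1 / 2) ^ n) with hd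
  have hgeo : HasSum (fun n : ℕ => 1 / 2 * (1 / 2 : ℝ) ^ n) 1 := by
    have := hasSum_geometric_two.mul_left (1 / 2 : ℝ)
    rwa [one_div_mul_cancel two_ne_zero] at this
  have hw1 : HasSum w 1 := by
    rw [← hasSum_nat_add_iff' 1]
    simpa [hw] using hgeo.mul_left (1 - θ)
  have hd1 : HasSum d (c + ε) := by
    rw [← hasSum_nat_add_iff' 1]
    have : c + ε - (c + ε / 2) = ε / 2 * 1 := by ring
    simpa [hd, this] using hgeo.mul_left (ε / 2)
  have hθ1' : 0 < 1 - θ := sub_pos.2 hθ1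
  refine ⟨(1 - θ) * ε / 8, by positivity, fun k g h0 hk hg => ?_⟩
  refine HullBound.hasSum (w := w) (c := d) (fun j => ?_) hw1 hd1 (fun j => ?_) hg
  · cases j
    · exact hθ0
    · simp only [hw]
      positivity
  · cases j with
    | zero =>
      refine h0.mono ?_
      change c ≤ (c + ε / 4) / (c + ε / 2) * (c + ε / 2)
      rw [div_mul_cancel₀ _ (by positivity)]
      linarith
    | succ n =>
      refine (hk n).mono (le_of_eq ?_)
      simp only [hw, hd]
      rw [show (1 / 4 : ℝ) = 1 / 2 * (1 / 2) by norm_num, mul_pow]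
      ring

variable (𝕜 p q F ι) in
/-- Adding a family with a small bound increases the bound only slightly. -/
theorem exists_add {c ε : ℝ} (hc : 0 ≤ c) (hε : 0 < ε) :
    ∃ D > 0, ∀ f g : ι → F, HullBound 𝕜 p q f c → HullBound 𝕜 p q g D →
      HullBound 𝕜 p q (fun i => f i + g i) (c + ε) := by
  obtain ⟨D, hD, h⟩ := exists_hasSum_of_geometric 𝕜 p q F ι hc hε
  refine ⟨D, hD, fun f g hf hg => h
    (fun j => Nat.casesOn j f fun n => Nat.casesOn n g fun _ _ => 0) _ hf (fun j => ?_) fun i => ?_⟩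
  · cases j with
    | zero => simpa using hg
    | succ n => exact zero 𝕜 p q (by positivity)
  · rw [← hasSum_nat_add_iff' 2]
    simp [Finset.sum_range_succ]

variable (𝕜 p q) in
/-- A family that takes finitely many values of small norm has a small bound. -/
theorem of_finite {κ : Type*} [Fintype κ] (j : ι → κ) {s : κ → F} {η : ℝ}
    (hs : ∀ l, ‖s l‖ ≤ η) : HullBound 𝕜 p q (fun i => s (j i)) (Fintype.card κ * η) := by
  set e : κ → ℕ := fun l => Fintype.equivFin κ l with he
  have hinj : e.Injective := Fin.val_injective.comp (Fintype.equivFin κ).injective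
  refine ⟨∑ l, lp.single p (e l) (s l),
    (strongSubgroup p F).sum_mem fun l _ => single_mem_strongSeq _ _, ?_,
    fun i => ⟨lp.single q (e (j i)) 1, ?_, ?_⟩⟩
  · refine (norm_sum_le_of_le (n := fun _ => η) Finset.univ fun l _ => ?_).trans_eq
      (by simp)
    rw [lp.norm_single (zero_lt_one.trans_le Fact.out)]
    exact hs l
  · rw [lp.norm_single (zero_lt_one.trans_le Fact.out), norm_one]
  · rw [pairing_single, one_smul, lp.coeFn_sum, Finset.sum_apply,
      Finset.sum_eq_single (j i) (fun l _ hl => ?_) (by simp)]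
    · exact lp.single_apply_self (E := fun _ : ℕ => F) _ _ _
    · exact lp.single_apply_ne (E := fun _ : ℕ => F) _ _ _ fun h => hl (hinj h).symm

end HullBound

end HullBound

/-! ### Passing from the bidual to the space -/

section Regularity

open NormedSpace

variable {𝕜 : Type*} [RCLike 𝕜] {p q : ℝ≥0∞} [Fact (1 ≤ p)] [Fact (1 ≤ q)]
  {F : Type*} [NormedAddCommGroup F] [NormedSpace 𝕜 F] {ι : Type*}

/-- Multiplication by a null sequence is a compact operator of `ℓ_q`: a family in the unit ball has
a finite subfamily whose image under it is a `δ`-net of the image of the family. -/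
theorem exists_finite_net {μ : ℕ → ℝ} (hμ0 : ∀ n, 0 ≤ μ n) (hμ1 : ∀ n, μ n ≤ 1)
    (hμ : Filter.Tendsto μ Filter.atTop (𝓝 0)) {a : ι → lp (fun _ : ℕ => 𝕜) q}
    (ha : ∀ i, ‖a i‖ ≤ 1) {δ : ℝ} (hδ : 0 < δ) :
    ∃ (m : ℕ) (l : Fin m → ι) (j : ι → Fin m), ∀ i, ∃ b : lp (fun _ : ℕ => 𝕜) q,
      ‖b‖ ≤ δ ∧ ∀ n, b n = (μ n : 𝕜) * (a i - a (l (j i))) n := by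
  obtain ⟨N, hN⟩ := Metric.tendsto_atTop.1 hμ (δ / 4) (by positivity)
  set η : ℝ := δ / (2 * (N + 1)) with hη
  have hη0 : 0 < η := by positivity
  set φ : ι → Fin N → 𝕜 := fun i n => a i n with hφ
  have htb : TotallyBounded (Set.range φ) := by
    refine (isCompact_closedBall (0 : Fin N → 𝕜) 1).totallyBounded.subset ?_
    rintro _ ⟨i, rfl⟩
    rw [mem_closedBall_zero_iff]
    exact (pi_norm_le_iff_of_nonneg zero_le_one).2 fun n =>
      (lp.norm_apply_le_norm ne_zero_of_fact (a i) n).trans (ha i)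
  obtain ⟨t, htφ, htf, ht⟩ := Metric.finite_approx_of_totallyBounded htb η hη0
  have := htf.fintype
  choose l hl using fun x : t => htφ x.2
  have hex : ∀ i, ∃ x : t, dist (φ i) x < η := fun i => by
    obtain ⟨x, hx, hix⟩ := Set.mem_iUnion₂.1 (ht ⟨i, rfl⟩)
    exact ⟨⟨x, hx⟩, hix⟩
  choose j hj using hex
  let e := Fintype.equivFin t
  refine ⟨Fintype.card t, fun x => l (e.symm x), fun i => e (j i), fun i => ?_⟩
  simp only [Equiv.symm_apply_apply]
  set d := a i - a (l (j i)) with hd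
  have hd2 : ‖d‖ ≤ 2 := (norm_sub_le _ _).trans (by linarith [ha i, ha (l (j i))])
  have hdn : ∀ n < N, ‖d n‖ ≤ η := fun n hn => by
    have h1 := (dist_le_pi_dist (φ i) (j i) ⟨n, hn⟩).trans (hj i).le
    rw [← hl (j i), dist_eq_norm] at h1
    exact h1
  -- the coordinates beyond `N` are small because of the multiplier, the others because of the net
  obtain ⟨r, hr, hrn⟩ := exists_mul_le (C := δ / 4) (by positivity) d
    (μ := fun n => if n < N then 0 else μ n) fun n => by
      split_ifs with h
      · simpa using by positivity
      · simpa using (hN n (not_lt.1 h)).le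
  refine ⟨∑ n ∈ Finset.range N, lp.single q n ((μ n : 𝕜) * d n) + r, ?_, fun n => ?_⟩
  · have h1 : ‖∑ n ∈ Finset.range N, lp.single (E := fun _ : ℕ => 𝕜) q n ((μ n : 𝕜) * d n)‖ ≤
        N * η := by
      refine (norm_sum_le_of_le (n := fun _ => η) _ fun n hn => ?_).trans_eq (by simp)
      rw [lp.norm_single (zero_lt_one.trans_le Fact.out), norm_mul, RCLike.norm_ofReal,
        abs_of_nonneg (hμ0 n)]
      exact (mul_le_of_le_one_left (norm_nonneg _) (hμ1 n)).trans (hdn n (Finset.mem_range.1 hn))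
    have h2 : N * η ≤ δ / 2 := by
      rw [hη, mul_div_assoc', div_le_div_iff₀ (by positivity) two_pos]
      nlinarith
    have h3 : δ / 4 * ‖d‖ ≤ δ / 4 * 2 := by gcongr
    refine (norm_add_le _ _).trans ?_
    linarith
  · rw [lp.coeFn_add, Pi.add_apply, hr, lp.coeFn_sum, Finset.sum_apply]
    simp only [lp.single_apply]
    rw [Finset.sum_pi_single]
    by_cases h : n < N <;> simp [h]

/-- A form of Goldstine's theorem: on a single functional `ψ`, an element of the bidual
is, up to a factor `θ < 1`, represented by a vector of no larger norm. -/
theorem exists_apply_eq_mul (ψ : StrongDual 𝕜 F) (x : StrongDual 𝕜 (StrongDual 𝕜 F)) {θ : ℝ}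
    (hθ0 : 0 ≤ θ) (hθ1 : θ < 1) : ∃ z : F, ‖z‖ ≤ ‖x‖ ∧ ψ z = θ * x ψ := by
  by_cases hψ : ψ = 0
  · exact ⟨0, by rw [norm_zero]; exact norm_nonneg x, by simp [hψ]⟩
  have hψ0 : 0 < ‖ψ‖ := norm_pos_iff.2 hψ
  obtain ⟨v, hv1, hv⟩ := ψ.exists_lt_apply_of_lt_opNorm
    (mul_lt_of_lt_one_left hψ0 hθ1)
  have hv0 : 0 < ‖ψ v‖ := (mul_nonneg hθ0 hψ0.le).trans_lt hv
  refine ⟨(θ * x ψ / ψ v) • v, ?_, ?_⟩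
  · rw [norm_smul, norm_div, norm_mul, RCLike.norm_ofReal, abs_of_nonneg hθ0]
    refine (mul_le_of_le_one_right (by positivity) hv1.le).trans ?_
    rw [div_le_iff₀ hv0]
    calc θ * ‖x ψ‖ ≤ θ * (‖x‖ * ‖ψ‖) := by gcongr; exact x.le_opNorm ψ
      _ = ‖x‖ * (θ * ‖ψ‖) := by ring
      _ ≤ ‖x‖ * ‖ψ v‖ := by gcongr
  · rw [map_smul, smul_eq_mul, div_mul_cancel₀ _ (norm_pos_iff.1 hv0)]

variable [q.HolderConjugate p] [CompleteSpace F]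

/-- Local reflexivity for finitely many coefficient sequences: if a sequence in the bidual
represents vectors of `F`, then so does approximately a sequence in `F` of no larger norm. By the
Hahn–Banach theorem, it suffices to test finite families of functionals, and these only see one
functional `ψ n` for each term of the sequence. -/
theorem exists_pairing_near {κ : Type*} [Fintype κ] {a : κ → lp (fun _ : ℕ => 𝕜) q}
    {y : lp (fun _ : ℕ => StrongDual 𝕜 (StrongDual 𝕜 F)) p} (hy : y ∈ strongSeq p _) {k : κ → F}
    (hk : ∀ l, pairing 𝕜 p q _ (a l) y = inclusionInDoubleDual 𝕜 F (k l)) {η : ℝ} (hη : 0 < η) :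
    ∃ z ∈ strongSeq p F, ‖z‖ ≤ ‖y‖ ∧ ∀ l, ‖k l - pairing 𝕜 p q F (a l) z‖ < η := by
  classical
  let _ : NormedSpace ℝ F := NormedSpace.restrictScalars ℝ 𝕜 F
  have : IsScalarTower ℝ 𝕜 F := inferInstance
  set A : Set (κ → F) :=
    {v | ∃ z ∈ strongSeq p F, ‖z‖ ≤ ‖y‖ ∧ ∀ l, pairing 𝕜 p q F (a l) z = v l} with hA
  have hconv : Convex ℝ A := by
    rintro v ⟨z, hz, hzy, hzv⟩ v' ⟨z', hz', hzy', hzv'⟩ s t hs ht hst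
    refine ⟨(s : 𝕜) • z + (t : 𝕜) • z',
      (strongSubgroup p F).add_mem (smul_mem_strongSeq _ hz) (smul_mem_strongSeq _ hz'), ?_,
      fun l => ?_⟩
    · refine (norm_add_le _ _).trans ?_
      rw [norm_smul, norm_smul, RCLike.norm_ofReal, RCLike.norm_ofReal, abs_of_nonneg hs,
        abs_of_nonneg ht]
      calc s * ‖z‖ + t * ‖z'‖ ≤ s * ‖y‖ + t * ‖y‖ := by gcongr
        _ = ‖y‖ := by rw [← add_mul, hst, one_mul]
    · rw [map_add, map_smul, map_smul, hzv, hzv', Pi.add_apply, Pi.smul_apply, Pi.smul_apply]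
      rfl
  by_cases hcl : k ∈ closure A
  · obtain ⟨v, ⟨z, hz, hzy, hzv⟩, hkv⟩ := Metric.mem_closure_iff.1 hcl η hη
    refine ⟨z, hz, hzy, fun l => ?_⟩
    rw [hzv, ← dist_eq_norm]
    exact (dist_le_pi_dist k v l).trans_lt hkv
  exfalso
  obtain ⟨f, u, hfu, hfk⟩ := RCLike.geometric_hahn_banach_closed_point (𝕜 := 𝕜) hconv.closure
    isClosed_closure hcl
  set φ : κ → StrongDual 𝕜 F :=
    fun l => f.comp (ContinuousLinearMap.single 𝕜 (fun _ : κ => F) l) with hφ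
  have hf : ∀ v, f v = ∑ l, φ l (v l) := fun v => by
    conv_lhs => rw [← Finset.univ_sum_single v]
    rw [map_sum]
    rfl
  have hu0 : 0 < u := by
    have h0 : (0 : κ → F) ∈ A :=
      ⟨0, (strongSubgroup p F).zero_mem, by simp, fun l => by simp⟩
    simpa using hfu 0 (subset_closure h0)
  have hr0 : 0 < RCLike.re (f k) := hu0.trans hfk
  -- For this `θ`, the test vector below has `re f = θ * re (f k) = u`, although it lies in `A`.
  set θ : ℝ := u / RCLike.re (f k) with hθ
  have hθ0 : 0 ≤ θ := by positivity
  have hθ1 : θ < 1 := (div_lt_one hr0).2 hfk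
  set ψ : ℕ → StrongDual 𝕜 F := fun n => ∑ l, a l n • φ l with hψ
  choose z0 hz0 hψz using fun n => exists_apply_eq_mul (ψ n) (y n) hθ0 hθ1
  obtain ⟨z, hz, hzn, hzy⟩ := exists_strongSeq_of_norm_le hy hz0
  have h1 : HasSum (fun n => ψ n (z n)) (f fun l => pairing 𝕜 p q F (a l) z) := by
    rw [hf]
    have : ∀ n, ψ n (z n) = ∑ l, φ l (a l n • z n) := fun n => by simp [hψ]
    simp_rw [this]
    exact hasSum_sum fun l _ => (φ l).hasSum (hasSum_pairing (a l) z)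
  have h2 : HasSum (fun n => y n (ψ n)) (f k) := by
    rw [hf]
    have : ∀ n, y n (ψ n) = ∑ l, (a l n • y n) (φ l) := fun n => by simp [hψ]
    simp_rw [this]
    refine hasSum_sum fun l _ => ?_
    have h3 := hasSum_pairing (a l) y
    rw [hk] at h3
    have h4 := (inclusionInDoubleDual 𝕜 (StrongDual 𝕜 F) (φ l)).hasSum h3
    simpa only [dual_def] using h4
  have h4 : f (fun l => pairing 𝕜 p q F (a l) z) = (θ : 𝕜) * f k := by
    refine h1.unique ?_
    simp_rw [hzn, hψz]
    exact h2.mul_left _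
  have h5 := hfu _ (subset_closure ⟨z, hz, hzy, fun l => rfl⟩)
  rw [h4, RCLike.re_ofReal_mul, hθ, div_mul_cancel₀ _ hr0.ne'] at h5
  exact h5.false

/-- Families in a `p`-convex hull are approximated by finitely many of their members. -/
theorem HullBound.exists_finite_approx {k : ι → F} {y : lp (fun _ : ℕ => F) p}
    (hy : y ∈ strongSeq p F) {a : ι → lp (fun _ : ℕ => 𝕜) q} (ha : ∀ i, ‖a i‖ ≤ 1)
    (hak : ∀ i, pairing 𝕜 p q F (a i) y = k i) {ε : ℝ} (hε : 0 < ε) :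
    ∃ (m : ℕ) (l : Fin m → ι) (j : ι → Fin m),
      HullBound 𝕜 p q (fun i => k i - k (l (j i))) ε := by
  obtain ⟨μ, hμ0, hμ1, hμ, u, hu, huy, hyu⟩ := exists_null_mul 𝕜 hy one_pos
  set δ : ℝ := ε / (‖y‖ + 1) with hδ
  have hδ0 : 0 < δ := by positivity
  have hδ' : (δ : 𝕜) ≠ 0 := by exact_mod_cast hδ0.ne'
  obtain ⟨m, l, j, hb⟩ := exists_finite_net hμ0 hμ1 hμ ha hδ0
  refine ⟨m, l, j, (δ : 𝕜) • u, smul_mem_strongSeq _ hu, ?_, fun i => ?_⟩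
  · rw [norm_smul, RCLike.norm_ofReal, abs_of_pos hδ0, hδ, div_mul_eq_mul_div,
      div_le_iff₀ (by positivity)]
    gcongr
  · obtain ⟨b, hbn, hb⟩ := hb i
    refine ⟨(δ : 𝕜)⁻¹ • b, ?_, ?_⟩
    · rw [norm_smul, norm_inv, RCLike.norm_ofReal, abs_of_pos hδ0, inv_mul_le_iff₀ hδ0, mul_one]
      exact hbn
    · rw [map_smul, map_smul, smul_apply, smul_smul, mul_inv_cancel₀ hδ', one_smul,
        pairing_eq_of_mul hb hyu, map_sub, sub_apply, hak, hak]

/-- A bound in the bidual gives almost the same bound in `F` for a family that approximates the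
given one, in the sense that the difference has a small bound in the bidual. -/
theorem HullBound.exists_approx {k : ι → F} {c : ℝ}
    (h : HullBound 𝕜 p q (fun i => inclusionInDoubleDual 𝕜 F (k i)) c) {ε : ℝ} (hε : 0 < ε) :
    ∃ f : ι → F, HullBound 𝕜 p q f (c + ε) ∧
      HullBound 𝕜 p q (fun i => inclusionInDoubleDual 𝕜 F (k i - f i)) ε := by
  have hc := h.nonneg
  obtain ⟨y, hy, hyc, ha⟩ := h
  choose a ha1 hak using ha
  obtain ⟨m, l, j, hlj⟩ := HullBound.exists_finite_approx hy ha1 hak hε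
  obtain ⟨D, hD, hadd⟩ := HullBound.exists_add 𝕜 p q F ι hc hε
  obtain ⟨z, hz, hzy, hkz⟩ := exists_pairing_near hy (fun x => hak (l x))
    (η := D / (m + 1)) (by positivity)
  refine ⟨fun i => k (l (j i)), ?_, by simpa only [map_sub] using hlj⟩
  have h1 : HullBound 𝕜 p q (fun i => pairing 𝕜 p q F (a (l (j i))) z) c :=
    ⟨z, hz, hzy.trans hyc, fun i => ⟨_, ha1 _, rfl⟩⟩
  have h2 := (HullBound.of_finite 𝕜 p q j fun x => (hkz x).le).mono (d := D) (by
    rw [Fintype.card_fin, mul_div_assoc', div_le_iff₀ (by positivity)]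
    nlinarith)
  simpa using hadd _ _ h1 h2

/-- A bound in the bidual for a family in `F` gives a bound in `F` that is larger by as little as
desired. -/
theorem HullBound.of_bidual {k : ι → F} {c : ℝ}
    (h : HullBound 𝕜 p q (fun i => inclusionInDoubleDual 𝕜 F (k i)) c) {ε : ℝ} (hε : 0 < ε) :
    HullBound 𝕜 p q k (c + ε) := by
  have hc := h.nonneg
  obtain ⟨D, hD, hsum⟩ := HullBound.exists_hasSum_of_geometric 𝕜 p q F ι
    (c := c + ε / 2) (ε := ε / 2) (by positivity) (by positivity)
  set e : ℕ → ℝ := fun n => min (ε / 2) (D / 2) * (1 / 4) ^ n with he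
  have hm : 0 < min (ε / 2) (D / 2) := by positivity
  have he0 : ∀ n, 0 < e n := fun n => by positivity
  -- `b n` bounds the `n`-th remainder in the bidual
  set b : ℕ → ℝ := fun n => Nat.casesOn n c e with hb
  have hstep : ∀ (n : ℕ) (r : ι → F),
      HullBound 𝕜 p q (fun i => inclusionInDoubleDual 𝕜 F (r i)) (b n) → ∃ f : ι → F,
        HullBound 𝕜 p q f (b n + e n) ∧
          HullBound 𝕜 p q (fun i => inclusionInDoubleDual 𝕜 F (r i - f i)) (b (n + 1)) :=
    fun n r hr => hr.exists_approx (he0 n)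
  choose! f hf1 hf2 using hstep
  let r : ℕ → ι → F := fun n => Nat.rec k (fun n r i => r i - f n r i) n
  have hr : ∀ n, HullBound 𝕜 p q (fun i => inclusionInDoubleDual 𝕜 F (r n i)) (b n) := fun n => by
    induction n with
    | zero => exact h
    | succ n ih => exact hf2 n (r n) ih
  have hnorm : ∀ n i, ‖r n i‖ ≤ b n := fun n i => by
    have := (hr n).norm_le i
    exact ((inclusionInDoubleDualLi 𝕜 (E := F)).norm_map _).symm.trans_le this
  have hesum : Summable e := (summable_geometric_of_lt_one (by norm_num) (by norm_num)).mul_left _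
  have hbsum : Summable b := (summable_nat_add_iff 1).1 hesum
  have hpart : ∀ n i, ∑ m ∈ Finset.range n, f m (r m) i = k i - r n i := fun n i => by
    induction n with
    | zero => simp [r]
    | succ n ih =>
      rw [Finset.sum_range_succ, ih]
      change k i - r n i + f n (r n) i = k i - (r n i - f n (r n) i)
      abel
  have key := hsum (fun n => f n (r n)) k ((hf1 0 (r 0) (hr 0)).mono ?_) (fun n => ?_) fun i => ?_
  · exact key.mono (by linarith)
  · change c + min (ε / 2) (D / 2) * (1 / 4) ^ 0 ≤ c + ε / 2
    rw [pow_zero, mul_one]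
    gcongr
    exact min_le_left _ _
  · refine (hf1 (n + 1) (r (n + 1)) (hr (n + 1))).mono ?_
    change e n + e (n + 1) ≤ _
    have h1 : e (n + 1) ≤ e n := by
      rw [he]
      simp only [pow_succ]
      exact mul_le_mul_of_nonneg_left (by nlinarith [pow_pos (show (0 : ℝ) < 1 / 4 by norm_num) n])
        hm.le
    have h2 : e n ≤ D / 2 * (1 / 4) ^ n := by
      simp only [he]
      gcongr
      exact min_le_right _ _
    linarith
  · have hsm : Summable fun n => ‖f n (r n) i‖ :=
      Summable.of_nonneg_of_le (fun n => norm_nonneg _)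
        (fun n => (hf1 n (r n) (hr n)).norm_le i) (hbsum.add hesum)
    rw [hasSum_iff_tendsto_nat_of_summable_norm hsm]
    simp_rw [hpart]
    have hr0 : Filter.Tendsto (fun n => r n i) Filter.atTop (𝓝 0) :=
      squeeze_zero_norm (fun n => hnorm n i) hbsum.tendsto_atTop_zero
    simpa using hr0.const_sub (k i)

end Regularity

/-! ### Dominating sequences, hulls, and transposes -/

section Duality

open NormedSpace

variable {𝕜 : Type*} [RCLike 𝕜] {p : ℝ≥0∞}
  {E : Type*} [NormedAddCommGroup E] [NormedSpace 𝕜 E]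
  {F : Type*} [NormedAddCommGroup F] [NormedSpace 𝕜 F]

/-- The operator `x ↦ (x'ₙ(x))ₙ` from `E` to `ℓ_p`. -/
def evalSeq (x' : lp (fun _ : ℕ => StrongDual 𝕜 E) p) : E →ₗ[𝕜] lp (fun _ : ℕ => 𝕜) p where
  toFun x := ⟨fun n => x' n x, (lp.memℓp ((‖x‖ : 𝕜) • x')).mono' fun n => by
    rw [lp.coeFn_smul, Pi.smul_apply, norm_smul, RCLike.norm_ofReal, abs_norm, mul_comm]
    exact (x' n).le_opNorm x⟩
  map_add' x y := by ext n; exact map_add (x' n) x y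
  map_smul' c x := by ext n; exact map_smul (x' n) c x

theorem evalSeq_apply (x' : lp (fun _ : ℕ => StrongDual 𝕜 E) p) (x : E) (n : ℕ) :
    evalSeq x' x n = x' n x := rfl

theorem evalSeq_mem_strongSeq {x' : lp (fun _ : ℕ => StrongDual 𝕜 E) p}
    (hx' : x' ∈ strongSeq p (StrongDual 𝕜 E)) (x : E) : evalSeq x' x ∈ strongSeq p 𝕜 := fun h => by
  have := (hx' h).norm.mul_const ‖x‖
  rw [norm_zero, zero_mul] at this
  exact squeeze_zero_norm (fun n => (x' n).le_opNorm x) this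

variable [Fact (1 ≤ p)]

theorem norm_eq_seqNorm {a : lp (fun _ : ℕ => 𝕜) p} : ‖a‖ = seqNorm p fun n => a n := by
  rw [seqNorm]
  split_ifs with h
  · subst h
    exact lp.norm_eq_ciSup a
  · exact lp.norm_eq_tsum_rpow (ENNReal.toReal_pos ne_zero_of_fact h) a

theorem norm_evalSeq (x' : lp (fun _ : ℕ => StrongDual 𝕜 E) p) (x : E) :
    ‖evalSeq x' x‖ = seqNorm p fun n => x' n x := norm_eq_seqNorm

/-- **Hölder's inequality** for the elements of the `p`-convex hull of a sequence of functionals. -/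
theorem norm_apply_le_of_mem_pConvexHull {x' : lp (fun _ : ℕ => StrongDual 𝕜 E) p}
    {f : StrongDual 𝕜 E} (hf : f ∈ pConvexHull 𝕜 p fun n => x' n) (x : E) :
    ‖f x‖ ≤ seqNorm p fun n => x' n x := by
  obtain ⟨a, -, ha, hs⟩ := hf
  have h1 : HasSum (fun n => a n • evalSeq x' x n) (f x) := by
    have h2 := (inclusionInDoubleDual 𝕜 E x).hasSum hs
    simpa only [dual_def, evalSeq_apply, smul_apply] using h2
  rw [← pairing_eq h1, ← norm_evalSeq]
  exact (norm_pairing_le _ _).trans (mul_le_of_le_one_left (norm_nonneg _) ha)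

theorem dominates_of_subset_pConvexHull {T : E →L[𝕜] F} {x' : lp (fun _ : ℕ => StrongDual 𝕜 E) p}
    (h : transpose T '' Metric.closedBall 0 1 ⊆ pConvexHull 𝕜 p fun n => x' n) :
    Dominates p (fun n => x' n) T := fun x => by
  obtain ⟨g, hg1, hg⟩ := exists_dual_vector'' 𝕜 (T x)
  have h1 := norm_apply_le_of_mem_pConvexHull (h ⟨g, mem_closedBall_zero_iff.2 hg1, rfl⟩) x
  rwa [transpose_apply, hg, RCLike.norm_ofReal, abs_norm] at h1

theorem nuQ_le_kappa_transpose (T : E →L[𝕜] F) : nuQ p T ≤ kappa p (transpose T) :=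
  le_iInf₂ fun x' hx' => iInf₂_le x' ⟨hx'.1, dominates_of_subset_pConvexHull hx'.2⟩

theorem nuQ_transpose_le_kappa (T : E →L[𝕜] F) : nuQ p (transpose T) ≤ kappa p T := by
  refine le_iInf₂ fun y ⟨hy, hT⟩ => ?_
  obtain ⟨w, hw, hwy, hwn⟩ := exists_strongSeq_of_norm_le hy
    (z := fun n => inclusionInDoubleDual 𝕜 F (y n)) fun n => double_dual_bound 𝕜 F (y n)
  refine (iInf₂_le w ⟨hw, fun y' => ?_⟩).trans (ENNReal.ofReal_le_ofReal hwn)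
  rw [← norm_evalSeq]
  refine (ContinuousLinearMap.opNorm_bound_of_ball_bound one_pos _ (transpose T y')
    fun x hx => ?_).trans_eq (div_one _)
  obtain ⟨a, -, ha, hs⟩ := hT ⟨x, hx, rfl⟩
  have h1 : HasSum (fun n => a n • evalSeq w y' n) (transpose T y' x) := by
    have h2 := y'.hasSum hs
    simpa only [evalSeq_apply, hwy, dual_def, map_smul, transpose_apply] using h2
  rw [← pairing_eq h1]
  exact (norm_pairing_le _ _).trans (mul_le_of_le_one_left (norm_nonneg _) ha)

/-- A functional dominated by an operator `R` into a normed space factors through `R`, with a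
functional of norm at most one (**Hahn–Banach**). -/
theorem exists_comp_eq_of_norm_le {X : Type*} [NormedAddCommGroup X] [NormedSpace 𝕜 X]
    (R : E →ₗ[𝕜] X) (f : E →ₗ[𝕜] 𝕜) (h : ∀ x, ‖f x‖ ≤ ‖R x‖) :
    ∃ g : StrongDual 𝕜 X, ‖g‖ ≤ 1 ∧ ∀ x, g (R x) = f x := by
  have hker : f ∈ R.ker.dualAnnihilator := by
    rw [Submodule.mem_dualAnnihilator]
    intro x hx
    have := h x
    rw [LinearMap.mem_ker.1 hx, norm_zero] at this
    exact norm_le_zero_iff.1 this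
  rw [← LinearMap.range_dualMap_eq_dualAnnihilator_ker] at hker
  obtain ⟨g0, rfl⟩ := hker
  let g1 : StrongDual 𝕜 R.range := (g0.comp R.range.subtype).mkContinuous 1 (by
    rintro ⟨_, x, rfl⟩
    simpa using h x)
  obtain ⟨g, hg, hgn⟩ := exists_extension_norm_eq R.range g1
  exact ⟨g, hgn.trans_le (LinearMap.mkContinuous_norm_le _ zero_le_one _),
    fun x => hg ⟨R x, x, rfl⟩⟩

/-- The transpose of a dominated operator maps the unit ball to the hull of the dominating
sequence, with the same norm. -/
theorem HullBound.of_dominates {T : E →L[𝕜] F} {x' : lp (fun _ : ℕ => StrongDual 𝕜 E) p}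
    (hx' : x' ∈ strongSeq p (StrongDual 𝕜 E)) (h : Dominates p (fun n => x' n) T) :
    HullBound 𝕜 p p.conjExponent
      (fun y' : Metric.closedBall (0 : StrongDual 𝕜 F) 1 => transpose T y') ‖x'‖ := by
  refine ⟨x', hx', le_rfl, fun ⟨y', hy'⟩ => ?_⟩
  obtain ⟨g, hg1, hg⟩ := exists_comp_eq_of_norm_le (evalSeq x') (transpose T y' : E →ₗ[𝕜] 𝕜)
    fun x => by
      rw [norm_evalSeq]
      refine le_trans ?_ (h x)
      exact (y'.le_opNorm (T x)).trans
        (mul_le_of_le_one_left (norm_nonneg _) (mem_closedBall_zero_iff.1 hy'))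
  obtain ⟨a, ha, han⟩ := exists_coeff p.conjExponent g
  refine ⟨a, han.trans hg1, ?_⟩
  ext x
  have h1 := (inclusionInDoubleDual 𝕜 E x).hasSum (hasSum_pairing a x')
  simp only [dual_def, map_smul] at h1
  have h2 := g.hasSum (hasSum_single_of_mem_strongSeq (evalSeq_mem_strongSeq hx' x))
  rw [hg] at h2
  refine h1.unique (h2.congr_fun fun n => ?_)
  have h3 : lp.single (E := fun _ : ℕ => 𝕜) p n (evalSeq x' x n) =
      x' n x • lp.single p n (1 : 𝕜) := by
    rw [← lp.single_smul, smul_eq_mul, mul_one, evalSeq_apply]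
  rw [h3, map_smul, ha, smul_eq_mul, smul_eq_mul, mul_comm]

theorem HullBound.kappa_le [CompleteSpace F] {T : E →L[𝕜] F} {c : ℝ}
    (h : HullBound 𝕜 p p.conjExponent (fun x : Metric.closedBall (0 : E) 1 => T x) c) :
    kappa p T ≤ ENNReal.ofReal c := by
  refine ENNReal.le_of_forall_pos_le_add fun ε hε _ => ?_
  obtain ⟨u, hu, huc, hT⟩ := h.exists_range_subset (NNReal.coe_pos.2 hε)
  rw [← ENNReal.ofReal_coe_nnreal, ← ENNReal.ofReal_add h.nonneg ε.coe_nonneg]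
  refine (iInf₂_le u ⟨hu, ?_⟩).trans (ENNReal.ofReal_le_ofReal huc)
  rwa [Set.image_eq_range]

theorem kappa_transpose_le_nuQ (T : E →L[𝕜] F) : kappa p (transpose T) ≤ nuQ p T :=
  le_iInf₂ fun _ hx' => (HullBound.of_dominates hx'.1 hx'.2).kappa_le

theorem kappa_le_nuQ_transpose [CompleteSpace F] (T : E →L[𝕜] F) :
    kappa p T ≤ nuQ p (transpose T) := by
  refine le_iInf₂ fun x' hx' => ENNReal.le_of_forall_pos_le_add fun ε hε _ => ?_
  rw [← ENNReal.ofReal_coe_nnreal, ← ENNReal.ofReal_add (norm_nonneg _) ε.coe_nonneg]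
  refine (HullBound.of_bidual ?_ (NNReal.coe_pos.2 hε)).kappa_le
  -- the bitranspose of `T` extends `T` along the embeddings into the biduals
  exact (HullBound.of_dominates hx'.1 hx'.2).comp fun x : Metric.closedBall (0 : E) 1 =>
    ⟨inclusionInDoubleDual 𝕜 E x, mem_closedBall_zero_iff.2
      ((double_dual_bound 𝕜 E x).trans (mem_closedBall_zero_iff.1 x.2))⟩

theorem mem_Kp_iff {T : E →L[𝕜] F} : T ∈ Kp 𝕜 p E F ↔ kappa p T ≠ ∞ := by
  simp [Kp, IsRelPCompact, kappa, iInf_eq_top]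

theorem mem_QNp_iff {T : E →L[𝕜] F} : T ∈ QNp 𝕜 p E F ↔ nuQ p T ≠ ∞ := by
  simp [QNp, nuQ, iInf_eq_top]

end Duality

end PCompact

theorem theorem2p7 {𝕜 : Type*} [RCLike 𝕜]
    {E : Type*} [NormedAddCommGroup E] [NormedSpace 𝕜 E] [CompleteSpace E]
    {F : Type*} [NormedAddCommGroup F] [NormedSpace 𝕜 F] [CompleteSpace F]
    (p : ℝ≥0∞) (hp : 1 ≤ p) :
    (PCompact.KpDual 𝕜 p E F = PCompact.QNp 𝕜 p E F ∧
      ∀ T : E →L[𝕜] F, PCompact.kappaDual p T = PCompact.nuQ p T) ∧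
    (PCompact.QNpDual 𝕜 p E F = PCompact.Kp 𝕜 p E F ∧
      ∀ T : E →L[𝕜] F, PCompact.nuQDual p T = PCompact.kappa p T) ∧
    (∀ T : E →L[𝕜] F,
      (T ∈ PCompact.Kp 𝕜 p E F ↔
        PCompact.transpose T ∈ PCompact.QNp 𝕜 p (StrongDual 𝕜 F) (StrongDual 𝕜 E)) ∧
      PCompact.kappa p T = PCompact.nuQ p (PCompact.transpose T)) := by
  have : Fact (1 ≤ p) := ⟨hp⟩
  have h1 : ∀ T : E →L[𝕜] F, PCompact.kappa p (PCompact.transpose T) = PCompact.nuQ p T := fun T =>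
    le_antisymm (PCompact.kappa_transpose_le_nuQ T) (PCompact.nuQ_le_kappa_transpose T)
  have h2 : ∀ T : E →L[𝕜] F, PCompact.nuQ p (PCompact.transpose T) = PCompact.kappa p T := fun T =>
    le_antisymm (PCompact.nuQ_transpose_le_kappa T) (PCompact.kappa_le_nuQ_transpose T)
  refine ⟨⟨Set.ext fun T => ?_, h1⟩, ⟨Set.ext fun T => ?_, h2⟩, fun T => ⟨?_, (h2 T).symm⟩⟩
  · rw [PCompact.mem_QNp_iff, ← h1]
    exact PCompact.mem_Kp_iff
  · rw [PCompact.mem_Kp_iff, ← h2]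
    exact PCompact.mem_QNp_iff
  · rw [PCompact.mem_Kp_iff, PCompact.mem_QNp_iff, h2]
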